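/- Consider a two-armed stochastic bandit in which arm $i\in\{1,2\}$ gives i.i.d. rewards $X_{i,1},X_{i,2},\dots\sim\mathcal N(\mu_i,\sigma_i^2)$ with $\sigma_1,\sigma_2>0$, rewards of different arms being independent, and let $\mu_1>\mu_2$. Let $J(t)$ be the arm pulled in round $t$, let $N_1(t)$ be the number of pulls of arm 1 before round $t$, and let $\mathrm{Regret}(T)=\sum_{t=1}^{T}(\mu_1-\mu_{J(t)})$. Fix $\alpha\ge 0$ and $n_0=\max\{2,3-\lceil 2\alpha\rceil\}$. Thompson sampling with arm 2 known is the following policy. In the first $2n_0$ rounds each arm is pulled $n_0$ times. In each later round $t$, a value $\tilde\mu_1(t)$ is sampled, with fresh randomness, from the posterior distribution of the mean of arm 1 given the $N_1(t)$ rewards obtained from it so far, under the improper prior with density $(\sigma_1^2)^{-1-\alpha}$ with respect to $\mathrm d\mu_1\,\mathrm d(\sigma_1^2)$ on $\mathbb R\times(0,\infty)$; one puts $\tilde\mu_2(t)=\mu_2$ and pulls an arm $i$ that maximizes $\tilde\mu_i(t)$. (The reference prior is $\alpha=0$, the Jeffreys prior is $\alpha=1/2$.) Then there is a constant $\xi>0$,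 depending only on $\alpha,\mu_1,\mu_2,\sigma_1$ and not on $\sigma_2$, such that $$\liminf_{T\to\infty}\frac{\mathrm E[\mathrm{Regret}(T)]}{\log T}\ge\xi .$$ Consequently the asymptotic lower bound for this problem is not achieved when $\sigma_2$ is small: there is $s>0$, depending only on $\alpha,\mu_1,\mu_2,\sigma_1$, such that for all $\sigma_2\in(0,s)$ $$\liminf_{T\to\infty}\frac{\mathrm E[\mathrm{Regret}(T)]}{\log T}>\frac{\mu_1-\mu_2}{\tfrac12\log\bigl(1+(\mu_1-\mu_2)^2/\sigma_2^2\bigr)} .$$ If moreover $\alpha>0$, then there are $\xi'>0$ and $\eta>0$, depending only on $\alpha,\mu_1,\mu_2,\sigma_1$, such that $$\liminf_{T\to\infty}\frac{\mathrm E[\mathrm{Regret}(T)]}{T^{\eta}}\ge\xi' ,$$ i.e. the regret is polynomial. (The lower limits may be $+\infty$.) -/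

import Mathlib

open MeasureTheory ProbabilityTheory Filter Set

universe u

namespace NormalBandit

noncomputable section

/-! ### Stochastic bandits

Arms are indexed by `Fin K`, and rounds, as well as the successive rewards of an arm, are indexed
from `0`.  `J t ω` is the arm pulled in round `t`. -/

/-- The gap `Δ_i = μ* - μ_i`, where `μ*` is the maximum of the expectations. -/
def gap {K : ℕ} (μ : Fin K → ℝ) (i : Fin K) : ℝ := (⨆ j, μ j) - μ i

/-- The number of times that the arm `i` is pulled before round `t`. -/
def pullCount {K : ℕ} {Ω : Type u} (J : ℕ → Ω → Fin K) (i : Fin K) (t : ℕ) (ω : Ω) : ℕ :=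
  ((Finset.range t).filter (fun s => J s ω = i)).card

/-- The regret after `T` rounds. -/
def regret {K : ℕ} {Ω : Type u} (μ : Fin K → ℝ) (J : ℕ → Ω → Fin K) (T : ℕ) (ω : Ω) : ℝ :=
  ∑ t ∈ Finset.range T, gap μ (J t ω)

/-- The expected regret after `T` rounds. -/
def expectedRegret {K : ℕ} {Ω : Type u} [MeasurableSpace Ω] (P : Measure Ω) (μ : Fin K → ℝ)
    (J : ℕ → Ω → Fin K) (T : ℕ) : ℝ :=
  ∫ ω, regret μ J T ω ∂P

/-- `D_inf(Δ, σ²) = (1/2) log (1 + Δ² / σ²)`, with second argument the variance. -/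
def Dinf (Δ v : ℝ) : ℝ := (1 / 2) * Real.log (1 + Δ ^ 2 / v)

/-! ### Bayesian posterior of the mean of a normal distribution -/

/-- The (improper) prior with density `(σ²)^(-1-α)` with respect to `dμ d(σ²)` on the parameters
`(μ, σ²)` in `ℝ × (0, ∞)`. -/
def prior (α : ℝ) : Measure (ℝ × ℝ) :=
  (volume.prod (volume.restrict (Ioi 0))).withDensity
    (fun p => ENNReal.ofReal (p.2 ^ (-1 - α)))

/-- The likelihood of the parameters `p = (μ, σ²)` given the first `n` terms of `x`, regarded as an
i.i.d. sample of `N(μ, σ²)`. -/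
def likelihood (n : ℕ) (x : ℕ → ℝ) (p : ℝ × ℝ) : ENNReal :=
  ∏ k ∈ Finset.range n, gaussianPDF p.1 p.2.toNNReal (x k)

/-- Prior times likelihood: the unnormalized posterior of `(μ, σ²)`. -/
def unnormalizedPosterior (α : ℝ) (n : ℕ) (x : ℕ → ℝ) : Measure (ℝ × ℝ) :=
  (prior α).withDensity (likelihood n x)

/-- The posterior distribution of the mean `μ`: the normalized posterior of `(μ, σ²)`, pushed
forward to its first coordinate.  (For `n ≥ 2` with `n + 2α > 1` and a sample that is not constant,
the normalizing constant is finite and positive.) -/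
def posteriorMean (α : ℝ) (n : ℕ) (x : ℕ → ℝ) : Measure ℝ :=
  ((unnormalizedPosterior α n x univ)⁻¹ • unnormalizedPosterior α n x).map Prod.fst

/-! ### Thompson sampling with two arms, the second of which is known -/

/-- The number `n₀ = max {2, 3 - ⌈2α⌉}` of initial pulls of each arm. -/
def initialPulls (α : ℝ) : ℕ := (max 2 (3 - ⌈2 * α⌉)).toNat

/-- The information before round `t`: the table of the rewards, and the sampled means and pulled
arms of the earlier rounds. -/
abbrev past {Ω : Type u} (X : Fin 2 → ℕ → Ω → ℝ) (θ : Fin 2 → ℕ → Ω → ℝ) (J : ℕ → Ω → Fin 2)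
    (t : ℕ) : MeasurableSpace Ω :=
  MeasurableSpace.comap
    (fun ω => ((fun i n => X i n ω, fun (s : Fin t) => (fun i => θ i s ω, J s ω)) :
      (Fin 2 → ℕ → ℝ) × (Fin t → (Fin 2 → ℝ) × Fin 2)))
    inferInstance

/-- A realization, on the probability space `(Ω, P)`, of Thompson sampling for the two-armed normal
bandit with expectations `μ i` and standard deviations `σ i`, where the arm `0` has the prior
`(σ²)^(-1-α)` and the arm `1` is known.  `X i n` is the `n`-th reward from the arm `i`, `θ i t` is
the mean sampled for the arm `i` in round `t`, and `J t` is the arm pulled in round `t`. -/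
structure IsThompsonKnownArm {Ω : Type u} [MeasurableSpace Ω] (P : Measure Ω) (α : ℝ)
    (μ σ : Fin 2 → ℝ) (X : Fin 2 → ℕ → Ω → ℝ) (θ : Fin 2 → ℕ → Ω → ℝ)
    (J : ℕ → Ω → Fin 2) : Prop where
  measurable_reward : ∀ i n, Measurable (X i n)
  measurable_sample : ∀ i t, Measurable (θ i t)
  measurable_arm : ∀ t, Measurable (J t)
  /-- The rewards are independent. -/
  indep_reward : iIndepFun (fun (p : Fin 2 × ℕ) => X p.1 p.2) P
  /-- The rewards from the arm `i` have the distribution `N(μ_i, σ_i²)`. -/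
  law_reward : ∀ i n, P.map (X i n) = gaussianReal (μ i) (σ i ^ 2).toNNReal
  /-- Initialization, in any order: each arm is pulled `n₀` times in the first `2 n₀` rounds. -/
  initialization : ∀ i ω, pullCount J i (2 * initialPulls α) ω = initialPulls α
  /-- Afterwards the mean of the arm `0` is sampled from the posterior given the rewards received
  from this arm so far, with fresh randomness. -/
  sample_zero : ∀ t, 2 * initialPulls α ≤ t → ∀ B : Set ℝ, MeasurableSet B →
    P⟦θ 0 t ⁻¹' B | past X θ J t⟧ =ᵐ[P]
      fun ω => (posteriorMean α (pullCount J 0 t ω) (fun n => X 0 n ω)).real B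
  /-- The sample for the known arm is its true expectation. -/
  sample_one : ∀ t, 2 * initialPulls α ≤ t → ∀ ω, θ 1 t ω = μ 1
  /-- An arm with the largest sampled mean is pulled. -/
  arm_maximizes : ∀ t, 2 * initialPulls α ≤ t → ∀ ω i, θ i t ω ≤ θ (J t ω) t ω

end

end NormalBandit

/-!
Given `n` rewards that are not all equal, the posterior of the mean `m` has a density proportional
to `(∑ k, (x k - m) ^ 2) ^ (-n / 2 - α)`: it is a Student distribution with `d = n - 1 + 2α` degrees
of freedom.  If the rewards lie in an interval of length `ε` at a distance of order `1` below the
mean `μ₂` of the known arm, the posterior mass above `μ₂` is therefore of order `ε ^ d`.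

The `n = n₀` initial rewards of arm 1 lie in such an interval with probability of order
`ε ^ (n - 1)` (one factor `ε` is regained because the location of the interval is free), and then
arm 1 is not pulled for about `ε ^ (-d)` rounds, during which its posterior does not change.  Taking
`ε` of order `k ^ (-1 / d)`, with probability at least of order `k ^ (-(n - 1) / d)` only arm 2 is
pulled in the first `k` rounds after the initialization.  The sum of these probabilities over `k`
bounds the regret from below; it grows logarithmically for `α = 0`, when the exponent is `-1`, and
polynomially for `α > 0`.
-/

namespace NormalBandit

/-! ### The posterior of the mean is a Student distribution -/

section SumSq

variable {ι : Type*} {s : Finset ι} {x : ι → ℝ}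

/-- The sum of the squared deviations of a sample from `m`.  As a function of `m`, a negative power
of it is an unnormalized Student density. -/
def sumSq (s : Finset ι) (x : ι → ℝ) (m : ℝ) : ℝ := ∑ i ∈ s, (x i - m) ^ 2

lemma sumSq_nonneg (s : Finset ι) (x : ι → ℝ) (m : ℝ) : 0 ≤ sumSq s x m :=
  Finset.sum_nonneg fun _ _ => sq_nonneg _

lemma continuous_sumSq (s : Finset ι) (x : ι → ℝ) : Continuous (sumSq s x) := by
  unfold sumSq
  fun_prop

lemma card_mul_sq_le_sumSq {m r : ℝ} (hr : 0 ≤ r) (h : ∀ i ∈ s, r ≤ |x i - m|) :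
    s.card * r ^ 2 ≤ sumSq s x m := by
  rw [← nsmul_eq_mul]
  refine s.card_nsmul_le_sum _ _ fun i hi => ?_
  rw [← sq_abs (x i - m)]
  exact pow_le_pow_left₀ hr (h i hi) 2

lemma sumSq_le_card_mul_sq {m r : ℝ} (h : ∀ i ∈ s, |x i - m| ≤ r) :
    sumSq s x m ≤ s.card * r ^ 2 := by
  rw [← nsmul_eq_mul]
  refine s.sum_le_card_nsmul _ _ fun i hi => ?_
  rw [← sq_abs (x i - m)]
  exact pow_le_pow_left₀ (abs_nonneg _) (h i hi) 2

/-- A sample that is not constant, the case in which the posterior is proper. -/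
def Nonconstant (s : Finset ι) (x : ι → ℝ) : Prop := ∃ i ∈ s, ∃ j ∈ s, x i ≠ x j

lemma Nonconstant.exists_mul_one_add_sq_le_sumSq (hx : Nonconstant s x) :
    ∃ δ > 0, ∃ m₀ : ℝ, ∀ m, δ * (1 + (m - m₀) ^ 2) ≤ sumSq s x m := by
  classical
  obtain ⟨i, hi, j, hj, hij⟩ := hx
  have hd : 0 < (x i - x j) ^ 2 / 2 := half_pos (sq_pos_of_ne_zero (sub_ne_zero.2 hij))
  refine ⟨min 2 ((x i - x j) ^ 2 / 2), lt_min two_pos hd, (x i + x j) / 2, fun m => ?_⟩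
  calc min 2 ((x i - x j) ^ 2 / 2) * (1 + (m - (x i + x j) / 2) ^ 2)
      ≤ (x i - x j) ^ 2 / 2 + 2 * (m - (x i + x j) / 2) ^ 2 := by
        rw [mul_one_add]
        gcongr
        · exact min_le_right _ _
        · exact min_le_left _ _
    _ = (x i - m) ^ 2 + (x j - m) ^ 2 := by ring
    _ ≤ sumSq s x m :=
        Finset.add_le_sum (f := fun k => (x k - m) ^ 2) (fun _ _ => sq_nonneg _) hi hj
          (ne_of_apply_ne x hij)

lemma Nonconstant.sumSq_pos (hx : Nonconstant s x) (m : ℝ) : 0 < sumSq s x m := by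
  obtain ⟨δ, hδ, m₀, h⟩ := hx.exists_mul_one_add_sq_le_sumSq
  exact lt_of_lt_of_le (by positivity) (h m)

lemma Nonconstant.card_pos (hx : Nonconstant s x) : 0 < s.card :=
  let ⟨i, hi, _⟩ := hx
  Finset.card_pos.2 ⟨i, hi⟩

lemma Nonconstant.integrable_sumSq_rpow (hx : Nonconstant s x) {β : ℝ} (hβ : 1 / 2 < β) :
    Integrable fun m => sumSq s x m ^ (-β) := by
  obtain ⟨δ, hδ, m₀, h⟩ := hx.exists_mul_one_add_sq_le_sumSq
  have hint : Integrable fun m : ℝ => (1 + ‖m - m₀‖ ^ 2) ^ (-(2 * β) / 2) :=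
    (integrable_rpow_neg_one_add_norm_sq (E := ℝ) (by simp; linarith)).comp_sub_right m₀
  have hmeas : AEStronglyMeasurable (fun m => sumSq s x m ^ (-β)) :=
    ((continuous_sumSq s x).rpow_const fun m => Or.inl (hx.sumSq_pos m).ne').aestronglyMeasurable
  refine (hint.const_mul (δ ^ (-β))).mono' hmeas (Eventually.of_forall fun m => ?_)
  rw [Real.norm_of_nonneg (Real.rpow_nonneg (sumSq_nonneg s x m) _),
    show -(2 * β) / 2 = -β by ring, ← Real.mul_rpow hδ.le (by positivity)]
  refine Real.rpow_le_rpow_of_nonpos (by positivity) ?_ (by linarith)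
  simpa only [Real.norm_eq_abs, sq_abs] using h m

lemma integral_Ioi_add_rpow_of_lt {a c m : ℝ} (ha : a < -1) (hc : -m < c) :
    ∫ t in Ioi c, (t + m) ^ a = -(c + m) ^ (a + 1) / (a + 1) := by
  have h := (measurePreserving_add_right (volume : Measure ℝ) m).setIntegral_preimage_emb
    (measurableEmbedding_addRight m) (fun t => t ^ a) (Ioi (c + m))
  rwa [preimage_add_const_Ioi, add_sub_cancel_right,
    integral_Ioi_rpow_of_lt ha (by linarith)] at h

variable {ν : ℝ}

lemma Nonconstant.setIntegral_Ici_sumSq_rpow_le (hx : Nonconstant s x) (hν : 0 < ν) {b y : ℝ}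
    (hb : ∀ i ∈ s, x i ≤ b) (hby : b < y) :
    ∫ m in Ici y, sumSq s x m ^ (-((ν + 1) / 2))
      ≤ (s.card : ℝ) ^ (-((ν + 1) / 2)) * ((y - b) ^ (-ν) / ν) := by
  have hcard : (0 : ℝ) < s.card := by exact_mod_cast hx.card_pos
  have hbound : ∀ m ∈ Ioi y, sumSq s x m ^ (-((ν + 1) / 2))
      ≤ (s.card : ℝ) ^ (-((ν + 1) / 2)) * (m + -b) ^ (-(ν + 1)) := by
    intro m (hm : y < m)
    have hmb : 0 < m + -b := by linarith
    rw [show -(ν + 1) = (2 : ℕ) * -((ν + 1) / 2) by push_cast; ring, Real.rpow_natCast_mul hmb.le,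
      ← Real.mul_rpow hcard.le (by positivity)]
    refine Real.rpow_le_rpow_of_nonpos (by positivity)
      (card_mul_sq_le_sumSq hmb.le fun i hi => ?_) (by linarith)
    rw [abs_sub_comm]
    exact le_trans (by linarith [hb i hi]) (le_abs_self _)
  calc ∫ m in Ici y, sumSq s x m ^ (-((ν + 1) / 2))
      = ∫ m in Ioi y, sumSq s x m ^ (-((ν + 1) / 2)) := integral_Ici_eq_integral_Ioi
    _ ≤ ∫ m in Ioi y, (s.card : ℝ) ^ (-((ν + 1) / 2)) * (m + -b) ^ (-(ν + 1)) :=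
        setIntegral_mono_on (hx.integrable_sumSq_rpow (by linarith)).integrableOn
          ((integrableOn_add_rpow_Ioi_of_lt (by linarith) (by linarith)).const_mul _)
          measurableSet_Ioi hbound
    _ = (s.card : ℝ) ^ (-((ν + 1) / 2)) * ((y - b) ^ (-ν) / ν) := by
        rw [integral_const_mul, integral_Ioi_add_rpow_of_lt (by linarith) (by linarith),
          show -(ν + 1) + 1 = -ν by ring, neg_div_neg_eq, ← sub_eq_add_neg]

lemma Nonconstant.le_integral_sumSq_rpow (hx : Nonconstant s x) (hν : 0 < ν) {a ε : ℝ}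
    (hε : 0 < ε) (ha : ∀ i ∈ s, x i ∈ Icc a (a + ε)) :
    (s.card : ℝ) ^ (-((ν + 1) / 2)) * ε ^ (-ν) ≤ ∫ m, sumSq s x m ^ (-((ν + 1) / 2)) := by
  have hint := hx.integrable_sumSq_rpow (β := (ν + 1) / 2) (by linarith)
  have hbound : ∀ m ∈ Icc a (a + ε),
      (s.card * ε ^ 2 : ℝ) ^ (-((ν + 1) / 2)) ≤ sumSq s x m ^ (-((ν + 1) / 2)) := fun m hm =>
    Real.rpow_le_rpow_of_nonpos (hx.sumSq_pos m)
      (sumSq_le_card_mul_sq fun i hi => abs_sub_le_iff.2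
        ⟨by linarith [(ha i hi).2, hm.1], by linarith [(ha i hi).1, hm.2]⟩) (by linarith)
  calc (s.card : ℝ) ^ (-((ν + 1) / 2)) * ε ^ (-ν)
      = (s.card * ε ^ 2 : ℝ) ^ (-((ν + 1) / 2)) * volume.real (Icc a (a + ε)) := by
        rw [Real.volume_real_Icc_of_le (by linarith), Real.mul_rpow (by positivity) (by positivity),
          ← Real.rpow_natCast_mul hε.le, mul_assoc, add_sub_cancel_left]
        congr 1
        rw [← Real.rpow_add_one hε.ne']
        congr 1
        push_cast
        ring
    _ ≤ ∫ m in Icc a (a + ε), sumSq s x m ^ (-((ν + 1) / 2)) :=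
        setIntegral_ge_of_const_le_real measurableSet_Icc (by simp) hbound hint.integrableOn
    _ ≤ ∫ m, sumSq s x m ^ (-((ν + 1) / 2)) :=
        setIntegral_le_integral hint
          (Eventually.of_forall fun m => Real.rpow_nonneg (sumSq_nonneg s x m) _)

end SumSq

lemma lintegral_rpow_mul_exp_neg_div_Ioi {β r : ℝ} (hβ : 0 < β) (hr : 0 < r) :
    ∫⁻ v in Ioi (0 : ℝ), ENNReal.ofReal (v ^ (-1 - β) * Real.exp (-(r / v)))
      = ENNReal.ofReal ((1 / r) ^ β * Real.Gamma β) := by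
  have hintegral : ∫ v in Ioi (0 : ℝ), v ^ (-1 - β) * Real.exp (-(r / v))
      = (1 / r) ^ β * Real.Gamma β := by
    have hsubst := integral_comp_rpow_Ioi (fun t : ℝ => t ^ (β - 1) * Real.exp (-(r * t)))
      (p := -1) (by norm_num)
    rw [Real.integral_rpow_mul_exp_neg_mul_Ioi hβ hr] at hsubst
    rw [← hsubst]
    refine setIntegral_congr_fun measurableSet_Ioi fun v (hv : 0 < v) => ?_
    simp only [smul_eq_mul, abs_neg, abs_one, one_mul]
    rw [← Real.rpow_mul hv.le, Real.rpow_neg_one, ← mul_assoc, ← Real.rpow_add hv, div_eq_mul_inv]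
    congr 2
    ring
  have hpos : 0 < (1 / r) ^ β * Real.Gamma β :=
    mul_pos (by positivity) (Real.Gamma_pos_of_pos hβ)
  rw [← hintegral, ofReal_integral_eq_lintegral_ofReal
    (.of_integral_ne_zero (hintegral ▸ hpos.ne'))]
  filter_upwards [ae_restrict_mem measurableSet_Ioi] with v (hv : 0 < v)
  simp only [Pi.zero_apply]
  positivity

lemma measurable_likelihood (n : ℕ) (x : ℕ → ℝ) : Measurable (likelihood n x) := by
  unfold likelihood gaussianPDF gaussianPDFReal
  fun_prop

lemma likelihood_eq_rpow_mul_exp (n : ℕ) (x : ℕ → ℝ) (m : ℝ) {v : ℝ} (hv : 0 < v) :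
    likelihood n x (m, v) = ENNReal.ofReal ((2 * Real.pi) ^ (-(n : ℝ) / 2) *
      (v ^ (-(n : ℝ) / 2) * Real.exp (-(sumSq (Finset.range n) x m / 2 / v)))) := by
  have hsqrt : (√(2 * Real.pi * v))⁻¹ ^ n
      = (2 * Real.pi) ^ (-(n : ℝ) / 2) * v ^ (-(n : ℝ) / 2) := by
    rw [← Real.mul_rpow (by positivity) hv.le, Real.sqrt_eq_rpow, ← Real.rpow_neg (by positivity),
      ← Real.rpow_natCast, ← Real.rpow_mul (by positivity)]
    congr 1
    ring
  have hexp : ∑ k ∈ Finset.range n, -(x k - m) ^ 2 / (2 * v)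
      = -(sumSq (Finset.range n) x m / 2 / v) := by
    rw [← Finset.sum_div, Finset.sum_neg_distrib, sumSq, div_div, neg_div]
  simp only [likelihood, gaussianPDF, gaussianPDFReal, Real.coe_toNNReal v hv.le]
  rw [← ENNReal.ofReal_prod_of_nonneg (fun _ _ => by positivity), Finset.prod_mul_distrib,
    Finset.prod_const, Finset.card_range, hsqrt, ← Real.exp_sum, hexp, mul_assoc]

/-- The number of degrees of freedom of the Student distribution that is the posterior of the mean
after `n` rewards; its density is proportional to the power `-(dof α n + 1) / 2` of `sumSq`. -/
def dof (α : ℝ) (n : ℕ) : ℝ := n - 1 + 2 * α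

section Posterior

variable {α : ℝ} {n : ℕ} {x : ℕ → ℝ}

lemma prior_mul_likelihood_eq (α : ℝ) (n : ℕ) (x : ℕ → ℝ) (m : ℝ) {v : ℝ} (hv : 0 < v) :
    ENNReal.ofReal (v ^ (-1 - α)) * likelihood n x (m, v)
      = ENNReal.ofReal ((2 * Real.pi) ^ (-(n : ℝ) / 2)) * ENNReal.ofReal
        (v ^ (-1 - (dof α n + 1) / 2) *
          Real.exp (-(sumSq (Finset.range n) x m / 2 / v))) := by
  rw [likelihood_eq_rpow_mul_exp n x m hv, ← ENNReal.ofReal_mul (by positivity),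
    ← ENNReal.ofReal_mul (by positivity),
    show -1 - (dof α n + 1) / 2 = (-1 - α) + -(n : ℝ) / 2 by rw [dof]; ring, Real.rpow_add hv]
  congr 1
  ring

/-- The factor between the unnormalized posterior of the mean and the power of `sumSq`. -/
noncomputable def posteriorFactor (α : ℝ) (n : ℕ) : ℝ :=
  (2 * Real.pi) ^ (-(n : ℝ) / 2) *
    (2 ^ ((dof α n + 1) / 2) * Real.Gamma ((dof α n + 1) / 2))

lemma posteriorFactor_pos (hν : 0 < dof α n) : 0 < posteriorFactor α n := by
  have := Real.Gamma_pos_of_pos (show 0 < (dof α n + 1) / 2 by linarith)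
  unfold posteriorFactor
  positivity

lemma setLIntegral_prior_mul_likelihood (hν : 0 < dof α n)
    (hx : Nonconstant (Finset.range n) x) (m : ℝ) :
    ∫⁻ v in Ioi (0 : ℝ), ENNReal.ofReal (v ^ (-1 - α)) * likelihood n x (m, v)
      = ENNReal.ofReal
        (posteriorFactor α n * sumSq (Finset.range n) x m ^ (-((dof α n + 1) / 2))) := by
  have hQ := hx.sumSq_pos m
  rw [setLIntegral_congr_fun measurableSet_Ioi fun v hv => prior_mul_likelihood_eq α n x m hv,
    lintegral_const_mul _ (by fun_prop),
    lintegral_rpow_mul_exp_neg_div_Ioi (by linarith) (half_pos hQ),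
    ← ENNReal.ofReal_mul (by positivity), one_div_div, Real.div_rpow two_pos.le hQ.le,
    Real.rpow_neg hQ.le, posteriorFactor]
  congr 1
  ring

lemma unnormalizedPosterior_prod_univ (hν : 0 < dof α n)
    (hx : Nonconstant (Finset.range n) x) {B : Set ℝ} (hB : MeasurableSet B) :
    unnormalizedPosterior α n x (B ×ˢ univ) = ENNReal.ofReal
      (posteriorFactor α n * ∫ m in B, sumSq (Finset.range n) x m ^ (-((dof α n + 1) / 2))) := by
  have hprior : Measurable fun p : ℝ × ℝ => ENNReal.ofReal (p.2 ^ (-1 - α)) := by fun_prop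
  have hlik := measurable_likelihood n x
  rw [unnormalizedPosterior, prior, ← withDensity_mul _ hprior hlik,
    withDensity_apply _ (hB.prod .univ), ← Measure.prod_restrict, Measure.restrict_univ,
    lintegral_prod _ (hprior.mul hlik).aemeasurable, ← integral_const_mul,
    ofReal_integral_eq_lintegral_ofReal]
  · exact lintegral_congr fun m => setLIntegral_prior_mul_likelihood hν hx m
  · exact ((hx.integrable_sumSq_rpow (by linarith)).const_mul _).integrableOn
  · exact Eventually.of_forall fun m => mul_nonneg (posteriorFactor_pos hν).le
      (Real.rpow_nonneg (sumSq_nonneg _ _ _) _)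

lemma integral_sumSq_rpow_pos (hν : 0 < dof α n) (hx : Nonconstant (Finset.range n) x) :
    0 < ∫ m, sumSq (Finset.range n) x m ^ (-((dof α n + 1) / 2)) := by
  refine (integral_pos_iff_support_of_nonneg
    (fun m => Real.rpow_nonneg (sumSq_nonneg _ _ m) _)
    (hx.integrable_sumSq_rpow (by linarith))).2 ?_
  rw [Function.support_eq_univ fun m => (Real.rpow_pos_of_pos (hx.sumSq_pos m) _).ne']
  simp

lemma posteriorMean_real (hν : 0 < dof α n) (hx : Nonconstant (Finset.range n) x) {B : Set ℝ}
    (hB : MeasurableSet B) :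
    (posteriorMean α n x).real B
      = (∫ m in B, sumSq (Finset.range n) x m ^ (-((dof α n + 1) / 2)))
        / ∫ m, sumSq (Finset.range n) x m ^ (-((dof α n + 1) / 2)) := by
  have hC := posteriorFactor_pos hν
  have hnonneg (S : Set ℝ) : 0 ≤ posteriorFactor α n *
      ∫ m in S, sumSq (Finset.range n) x m ^ (-((dof α n + 1) / 2)) :=
    mul_nonneg hC.le (integral_nonneg fun m => Real.rpow_nonneg (sumSq_nonneg _ _ m) _)
  rw [measureReal_def, posteriorMean, Measure.map_apply measurable_fst hB, ← prod_univ,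
    Measure.smul_apply, smul_eq_mul, ← univ_prod_univ, unnormalizedPosterior_prod_univ hν hx .univ,
    unnormalizedPosterior_prod_univ hν hx hB, ENNReal.toReal_mul, ENNReal.toReal_inv,
    ENNReal.toReal_ofReal (hnonneg _), ENNReal.toReal_ofReal (hnonneg _), Measure.restrict_univ,
    inv_mul_eq_div, mul_div_mul_left _ _ hC.ne']

lemma isProbabilityMeasure_posteriorMean (hν : 0 < dof α n)
    (hx : Nonconstant (Finset.range n) x) : IsProbabilityMeasure (posteriorMean α n x) := by
  rw [isProbabilityMeasure_iff_real, posteriorMean_real hν hx .univ, Measure.restrict_univ,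
    div_self (integral_sumSq_rpow_pos hν hx).ne']

lemma posteriorMean_real_Ici_le (hν : 0 < dof α n) (hx : Nonconstant (Finset.range n) x)
    {a ε b y : ℝ} (hε : 0 < ε) (ha : ∀ k < n, x k ∈ Icc a (a + ε)) (hb : ∀ k < n, x k ≤ b)
    (hby : b < y) :
    (posteriorMean α n x).real (Ici y) ≤ (ε / (y - b)) ^ dof α n / dof α n := by
  have hyb : 0 < y - b := sub_pos.2 hby
  have htail := hx.setIntegral_Ici_sumSq_rpow_le hν (by simpa using hb) hby
  have htotal := hx.le_integral_sumSq_rpow hν hε (by simpa using ha)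
  rw [posteriorMean_real hν hx measurableSet_Ici, div_le_iff₀ (integral_sumSq_rpow_pos hν hx)]
  refine htail.trans (le_trans (le_of_eq ?_) (mul_le_mul_of_nonneg_left htotal (by positivity)))
  rw [Real.div_rpow hε.le hyb.le, Real.rpow_neg hε.le, Real.rpow_neg hyb.le]
  field_simp

lemma one_sub_le_posteriorMean_real_Iio (hν : 0 < dof α n) (hx : Nonconstant (Finset.range n) x)
    {a ε b y : ℝ} (hε : 0 < ε) (ha : ∀ k < n, x k ∈ Icc a (a + ε)) (hb : ∀ k < n, x k ≤ b)
    (hby : b < y) :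
    1 - (ε / (y - b)) ^ dof α n / dof α n ≤ (posteriorMean α n x).real (Iio y) := by
  have := isProbabilityMeasure_posteriorMean hν hx
  rw [← compl_Ici, probReal_compl_eq_one_sub measurableSet_Ici]
  exact sub_le_sub_left (posteriorMean_real_Ici_le hν hx hε ha hb hby) 1

end Posterior

/-! ### Clustered samples -/

section Cluster

variable {Ω : Type*} {X : ℕ → Ω → ℝ} {n : ℕ} {b ε : ℝ}

/-- The range of the term of index `k` of a sample clustered in `[b, b + 2ε)`: the first half of
this interval for `k = 0` and the second half otherwise, so that such a sample is not constant. -/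
def clusterCell (b ε : ℝ) (k : ℕ) : Set ℝ :=
  if k = 0 then Ico b (b + ε) else Ico (b + ε) (b + ε + ε)

/-- The event that the first `n` terms of `X` are clustered in `[b, b + 2ε)`. -/
def cluster (X : ℕ → Ω → ℝ) (n : ℕ) (b ε : ℝ) : Set Ω :=
  ⋂ k ∈ Finset.range n, X k ⁻¹' clusterCell b ε k

lemma measurableSet_clusterCell (b ε : ℝ) (k : ℕ) : MeasurableSet (clusterCell b ε k) := by
  unfold clusterCell
  split_ifs <;> exact measurableSet_Ico

lemma clusterCell_subset (hε : 0 ≤ ε) (b : ℝ) (k : ℕ) :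
    clusterCell b ε k ⊆ Ico b (b + ε + ε) := by
  unfold clusterCell
  split_ifs
  · exact Ico_subset_Ico_right (by linarith)
  · exact Ico_subset_Ico_left (by linarith)

lemma measurableSet_cluster [MeasurableSpace Ω] (hX : ∀ k, Measurable (X k)) (n : ℕ) (b ε : ℝ) :
    MeasurableSet (cluster X n b ε) :=
  Finset.measurableSet_biInter _ fun k _ => hX k (measurableSet_clusterCell b ε k)

lemma mem_clusterCell_of_mem_cluster {ω : Ω} (hω : ω ∈ cluster X n b ε) {k : ℕ} (hk : k < n) :
    X k ω ∈ clusterCell b ε k :=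
  mem_iInter₂.1 hω k (Finset.mem_range.2 hk)

lemma nonconstant_of_mem_cluster (hn : 2 ≤ n) {ω : Ω} (hω : ω ∈ cluster X n b ε) :
    Nonconstant (Finset.range n) fun k => X k ω := by
  have h0 : X 0 ω < b + ε := (mem_clusterCell_of_mem_cluster hω (by lia : 0 < n)).2
  have h1 : b + ε ≤ X 1 ω := (mem_clusterCell_of_mem_cluster hω (by lia : 1 < n)).1
  exact ⟨0, Finset.mem_range.2 (by lia), 1, Finset.mem_range.2 (by lia), (h0.trans_le h1).ne⟩

lemma disjoint_cluster {b' : ℝ} (hn : 0 < n) (hε : 0 ≤ ε) (hb : b + ε + ε ≤ b') :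
    Disjoint (cluster X n b ε) (cluster X n b' ε) :=
  disjoint_left.2 fun _ h h' =>
    ((clusterCell_subset hε _ _ (mem_clusterCell_of_mem_cluster h hn)).2.trans_le hb).not_ge
      (clusterCell_subset hε _ _ (mem_clusterCell_of_mem_cluster h' hn)).1

/-- The event that the first `n` terms of `X` are clustered in one of the first `M` successive
intervals of length `2ε` to the right of `a`. -/
def clustered (X : ℕ → Ω → ℝ) (n : ℕ) (a ε : ℝ) (M : ℕ) : Set Ω :=
  ⋃ j ∈ Finset.range M, cluster X n (a + 2 * j * ε) ε

lemma measurableSet_clustered [MeasurableSpace Ω] (hX : ∀ k, Measurable (X k)) (n : ℕ) (a ε : ℝ)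
    (M : ℕ) : MeasurableSet (clustered X n a ε M) :=
  Finset.measurableSet_biUnion _ fun _ _ => measurableSet_cluster hX n _ ε

lemma add_two_mul_mul_le {i j : ℕ} (hij : i < j) (hε : 0 ≤ ε) (a : ℝ) :
    a + 2 * i * ε + ε + ε ≤ a + 2 * j * ε := by
  have hij' : (i + 1 : ℝ) ≤ j := mod_cast hij
  nlinarith

lemma pairwiseDisjoint_cluster (hn : 0 < n) (hε : 0 ≤ ε) (a : ℝ) (s : Set ℕ) :
    s.PairwiseDisjoint fun j : ℕ => cluster X n (a + 2 * j * ε) ε := by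
  rintro i - j - hij
  rcases hij.lt_or_gt with h | h
  · exact disjoint_cluster hn hε (add_two_mul_mul_le h hε a)
  · exact (disjoint_cluster hn hε (add_two_mul_mul_le h hε a)).symm

lemma one_sub_le_posteriorMean_real_Iio_of_mem_clustered {α a y : ℝ} {M : ℕ} {ω : Ω}
    (hν : 0 < dof α n) (hn : 2 ≤ n) (hε : 0 < ε) (hy : a + 2 * M * ε < y)
    (hω : ω ∈ clustered X n a ε M) :
    1 - ((2 * ε) / (y - (a + 2 * M * ε))) ^ dof α n / dof α n
      ≤ (posteriorMean α n fun k => X k ω).real (Iio y) := by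
  obtain ⟨j, hj, hωj⟩ := mem_iUnion₂.1 hω
  have hright := add_two_mul_mul_le (Finset.mem_range.1 hj) hε.le a
  have hmem (k : ℕ) (hk : k < n) :=
    clusterCell_subset hε.le _ _ (mem_clusterCell_of_mem_cluster hωj hk)
  exact one_sub_le_posteriorMean_real_Iio hν (nonconstant_of_mem_cluster hn hωj)
    (a := a + 2 * j * ε) (by positivity)
    (fun k hk => ⟨(hmem k hk).1, (hmem k hk).2.le.trans_eq (by ring)⟩)
    (fun k hk => (hmem k hk).2.le.trans hright) hy

variable [MeasurableSpace Ω] {P : Measure Ω} {ν : Measure ℝ} {p : ℝ}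

lemma pow_le_measureReal_cluster (hind : iIndepFun X P) (hX : ∀ k, Measurable (X k))
    (hlaw : ∀ k, P.map (X k) = ν) (hp : 0 ≤ p) (hcell : ∀ k, p ≤ ν.real (clusterCell b ε k))
    (n : ℕ) : p ^ n ≤ P.real (cluster X n b ε) := by
  rw [measureReal_def, cluster,
    hind.measure_inter_preimage_eq_mul _ fun k _ => measurableSet_clusterCell b ε k,
    ENNReal.toReal_prod]
  calc p ^ n = ∏ _k ∈ Finset.range n, p := by rw [Finset.prod_const, Finset.card_range]
    _ ≤ _ := Finset.prod_le_prod (fun _ _ => hp) fun k _ => by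
        rw [← Measure.map_apply (hX k) (measurableSet_clusterCell b ε k), hlaw]
        exact hcell k

lemma mul_pow_le_measureReal_clustered [IsFiniteMeasure P] (hind : iIndepFun X P)
    (hX : ∀ k, Measurable (X k)) (hlaw : ∀ k, P.map (X k) = ν) (hn : 0 < n) (hε : 0 ≤ ε) {a : ℝ}
    {M : ℕ} (hp : 0 ≤ p)
    (hIco : ∀ s, a ≤ s → s + ε ≤ a + 2 * M * ε → p ≤ ν.real (Ico s (s + ε))) :
    M * p ^ n ≤ P.real (clustered X n a ε M) := by
  rw [clustered, measureReal_biUnion_finset (pairwiseDisjoint_cluster hn hε a _)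
    fun j _ => measurableSet_cluster hX n _ ε]
  calc M * p ^ n = ∑ _j ∈ Finset.range M, p ^ n := by
        rw [Finset.sum_const, Finset.card_range, nsmul_eq_mul]
    _ ≤ _ := Finset.sum_le_sum fun j hj => ?_
  have hleft : a ≤ a + 2 * j * ε := le_add_of_nonneg_right (by positivity)
  have hright := add_two_mul_mul_le (Finset.mem_range.1 hj) hε a
  refine pow_le_measureReal_cluster hind hX hlaw hp (fun k => ?_) n
  unfold clusterCell
  split_ifs
  · exact hIco _ hleft (by linarith)
  · exact hIco _ (by linarith) hright

end Cluster

section Gaussian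

variable {m a s t : ℝ} {v : NNReal}

lemma monotoneOn_gaussianPDFReal (m : ℝ) (v : NNReal) :
    MonotoneOn (gaussianPDFReal m v) (Iic m) := by
  intro s _ t (ht : t ≤ m) hst
  have hsq : (t - m) ^ 2 ≤ (s - m) ^ 2 := by nlinarith
  unfold gaussianPDFReal
  gcongr

lemma gaussianPDFReal_mul_le_gaussianReal_real_Ico (hv : v ≠ 0) (has : a ≤ s) (hst : s ≤ t)
    (htm : t ≤ m) : gaussianPDFReal m v a * (t - s) ≤ (gaussianReal m v).real (Ico s t) := by
  rw [measureReal_def, gaussianReal_apply_eq_integral _ hv,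
    ENNReal.toReal_ofReal (integral_nonneg fun x => gaussianPDFReal_nonneg _ _ _),
    ← Real.volume_real_Ico_of_le hst]
  exact setIntegral_ge_of_const_le_real measurableSet_Ico (by simp)
    (fun x hx => monotoneOn_gaussianPDFReal m v (by grind) (by grind) (has.trans hx.1))
    (integrable_gaussianPDFReal m v).integrableOn

end Gaussian

/-! ### The rounds in which the known arm is pulled -/

lemma mul_measureReal_le_measureReal_inter {Ω : Type*} {m mΩ : MeasurableSpace Ω} {P : Measure Ω}
    [IsFiniteMeasure P] {A B : Set Ω} {q : ℝ} (hm : m ≤ mΩ) (hA : MeasurableSet[m] A)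
    (hB : MeasurableSet B) (hq : ∀ᵐ ω ∂P, ω ∈ A → q ≤ (P⟦B | m⟧) ω) :
    q * P.real A ≤ P.real (A ∩ B) := by
  calc q * P.real A = ∫ _ in A, q ∂P := by rw [setIntegral_const, smul_eq_mul, mul_comm]
    _ ≤ ∫ ω in A, (P⟦B | m⟧) ω ∂P := setIntegral_mono_on_ae (integrableOn_const (by simp))
        integrable_condExp.integrableOn (hm _ hA) hq
    _ = ∫ ω in A, B.indicator (fun _ => (1 : ℝ)) ω ∂P :=
        setIntegral_condExp hm ((integrable_const 1).indicator hB) hA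
    _ = P.real (A ∩ B) := by
        rw [setIntegral_indicator hB, setIntegral_const, smul_eq_mul, mul_one]

/-- The event that the means sampled in the rounds `t₀, …, t₀ + k - 1` are below `y`. -/
def sampleBelow {Ω : Type*} (θ : ℕ → Ω → ℝ) (y : ℝ) (t₀ k : ℕ) : Set Ω :=
  ⋂ s ∈ Finset.range k, θ (t₀ + s) ⁻¹' Iio y

lemma sampleBelow_zero {Ω : Type*} (θ : ℕ → Ω → ℝ) (y : ℝ) (t₀ : ℕ) :
    sampleBelow θ y t₀ 0 = univ := by
  simp [sampleBelow]

lemma sampleBelow_succ {Ω : Type*} (θ : ℕ → Ω → ℝ) (y : ℝ) (t₀ k : ℕ) :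
    sampleBelow θ y t₀ (k + 1) = sampleBelow θ y t₀ k ∩ θ (t₀ + k) ⁻¹' Iio y := by
  simp only [sampleBelow, Finset.range_add_one, Finset.set_biInter_insert]
  exact inter_comm _ _

section Past

variable {Ω : Type u} {X θ : Fin 2 → ℕ → Ω → ℝ} {J : ℕ → Ω → Fin 2}

lemma measurable_reward_past (i : Fin 2) (n t : ℕ) : Measurable[past X θ J t] (X i n) :=
  have hf : Measurable fun p : (Fin 2 → ℕ → ℝ) × (Fin t → (Fin 2 → ℝ) × Fin 2) => p.1 i n := by
    fun_prop
  hf.comp (comap_measurable _)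

lemma measurable_sample_past (i : Fin 2) {s t : ℕ} (hs : s < t) :
    Measurable[past X θ J t] (θ i s) :=
  have hf : Measurable fun p : (Fin 2 → ℕ → ℝ) × (Fin t → (Fin 2 → ℝ) × Fin 2) =>
      (p.2 ⟨s, hs⟩).1 i := by fun_prop
  hf.comp (comap_measurable _)

lemma measurableSet_sampleBelow_past (i : Fin 2) (y : ℝ) (t₀ k : ℕ) :
    MeasurableSet[past X θ J (t₀ + k)] (sampleBelow (θ i) y t₀ k) :=
  Finset.measurableSet_biInter _ fun _ hs =>
    measurable_sample_past i (Nat.add_lt_add_left (Finset.mem_range.1 hs) t₀) measurableSet_Iio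

end Past

namespace IsThompsonKnownArm

variable {Ω : Type u} [mΩ : MeasurableSpace Ω] {P : Measure Ω} {α : ℝ} {μ σ : Fin 2 → ℝ}
  {X θ : Fin 2 → ℕ → Ω → ℝ} {J : ℕ → Ω → Fin 2}

lemma past_le (h : IsThompsonKnownArm P α μ σ X θ J) (t : ℕ) : past X θ J t ≤ mΩ := by
  refine Measurable.comap_le (Measurable.prodMk ?_ ?_)
  · exact measurable_pi_lambda _ fun i => measurable_pi_lambda _ fun n => h.measurable_reward i n
  · exact measurable_pi_lambda _ fun s => Measurable.prodMk
      (measurable_pi_lambda _ fun i => h.measurable_sample i s) (h.measurable_arm s)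

lemma arm_eq_one (h : IsThompsonKnownArm P α μ σ X θ J) {t : ℕ} (ht : 2 * initialPulls α ≤ t)
    {ω : Ω} (hω : θ 0 t ω < μ 1) : J t ω = 1 := by
  have hmax := h.arm_maximizes t ht ω 1
  rw [h.sample_one t ht ω] at hmax
  refine Fin.eq_one_of_ne_zero _ fun hJ => ?_
  rw [hJ] at hmax
  exact hω.not_ge hmax

lemma pullCount_zero_eq (h : IsThompsonKnownArm P α μ σ X θ J) {k : ℕ} {ω : Ω}
    (hω : ω ∈ sampleBelow (θ 0) (μ 1) (2 * initialPulls α) k) :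
    pullCount J 0 (2 * initialPulls α + k) ω = initialPulls α := by
  induction k with
  | zero => exact h.initialization 0 ω
  | succ k ih =>
    rw [sampleBelow_succ] at hω
    have hJ : J (2 * initialPulls α + k) ω ≠ 0 := by
      simp [h.arm_eq_one (Nat.le_add_right _ _) hω.2]
    rw [← add_assoc, pullCount, Finset.range_add_one, Finset.filter_insert, if_neg hJ]
    exact ih hω.1

lemma pow_mul_measureReal_le_measureReal_sampleBelow [IsProbabilityMeasure P]
    (h : IsThompsonKnownArm P α μ σ X θ J) {G : Set Ω} (hG : ∀ t, MeasurableSet[past X θ J t] G)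
    {q : ℝ} (hq : 0 ≤ q)
    (hGq : ∀ ω ∈ G, q ≤ (posteriorMean α (initialPulls α) fun n => X 0 n ω).real (Iio (μ 1)))
    (k : ℕ) :
    q ^ k * P.real G ≤ P.real (G ∩ sampleBelow (θ 0) (μ 1) (2 * initialPulls α) k) := by
  induction k with
  | zero => simp [sampleBelow_zero]
  | succ k ih =>
    set t := 2 * initialPulls α + k
    set A := sampleBelow (θ 0) (μ 1) (2 * initialPulls α) k
    have hB : MeasurableSet (θ 0 t ⁻¹' Iio (μ 1)) := h.measurable_sample 0 t measurableSet_Iio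
    -- As long as only the arm `1` is pulled, the posterior is the one after the initialization.
    have hcond : ∀ᵐ ω ∂P, ω ∈ G ∩ A → q ≤ (P⟦θ 0 t ⁻¹' Iio (μ 1) | past X θ J t⟧) ω := by
      filter_upwards [h.sample_zero t (Nat.le_add_right _ _) _ measurableSet_Iio]
        with ω hω ⟨hωG, hωA⟩
      rw [hω, h.pullCount_zero_eq hωA]
      exact hGq ω hωG
    calc q ^ (k + 1) * P.real G = q * (q ^ k * P.real G) := by ring
      _ ≤ q * P.real (G ∩ A) := mul_le_mul_of_nonneg_left ih hq
      _ ≤ P.real ((G ∩ A) ∩ θ 0 t ⁻¹' Iio (μ 1)) :=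
          mul_measureReal_le_measureReal_inter (h.past_le t)
            ((hG t).inter (measurableSet_sampleBelow_past 0 _ _ _)) hB hcond
      _ = _ := by rw [inter_assoc, ← sampleBelow_succ]

end IsThompsonKnownArm

/-! ### Regret -/

section Regret

variable {K : ℕ} {Ω : Type u} [MeasurableSpace Ω] {P : Measure Ω} {J : ℕ → Ω → Fin K}

lemma sub_le_gap (μ : Fin K → ℝ) (i j : Fin K) : μ j - μ i ≤ gap μ i :=
  sub_le_sub_right (le_ciSup (Set.finite_range μ).bddAbove j) _

lemma gap_nonneg (μ : Fin K → ℝ) (i : Fin K) : 0 ≤ gap μ i := by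
  simpa using sub_le_gap μ i i

lemma gap_mul_sum_le_expectedRegret [IsFiniteMeasure P] (μ : Fin K → ℝ)
    (hJ : ∀ t, Measurable (J t)) (i : Fin K) (T : ℕ) :
    gap μ i * ∑ t ∈ Finset.range T, P.real (J t ⁻¹' {i}) ≤ expectedRegret P μ J T := by
  have hmeas (t : ℕ) : MeasurableSet (J t ⁻¹' {i}) := hJ t (measurableSet_singleton i)
  have hint (t : ℕ) : Integrable (fun ω => gap μ (J t ω)) P :=
    (Integrable.of_finite (μ := P.map (J t)) (f := gap μ)).comp_measurable (hJ t)
  unfold expectedRegret regret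
  rw [integral_finsetSum _ fun t _ => hint t, Finset.mul_sum]
  refine Finset.sum_le_sum fun t _ => ?_
  rw [mul_comm, ← smul_eq_mul, ← integral_indicator_const _ (hmeas t)]
  refine integral_mono ((integrable_const _).indicator (hmeas t)) (hint t) fun ω => ?_
  exact indicator_apply_le' (fun hω => (congrArg (gap μ) hω).ge) fun _ => gap_nonneg μ _

end Regret

lemma IsThompsonKnownArm.sub_mul_sum_le_expectedRegret {Ω : Type u} [MeasurableSpace Ω]
    {P : Measure Ω} [IsProbabilityMeasure P] {α : ℝ} {μ σ : Fin 2 → ℝ}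
    {X θ : Fin 2 → ℕ → Ω → ℝ} {J : ℕ → Ω → Fin 2} (h : IsThompsonKnownArm P α μ σ X θ J) (K : ℕ) :
    (μ 0 - μ 1) * ∑ k ∈ Finset.range K,
      P.real (sampleBelow (θ 0) (μ 1) (2 * initialPulls α) (k + 1))
      ≤ expectedRegret P μ J (2 * initialPulls α + K) := by
  have hpulled (k : ℕ) : sampleBelow (θ 0) (μ 1) (2 * initialPulls α) (k + 1)
      ⊆ J (2 * initialPulls α + k) ⁻¹' {1} := by
    rw [sampleBelow_succ]
    exact fun ω hω => h.arm_eq_one (Nat.le_add_right _ _) hω.2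
  refine le_trans ?_ (gap_mul_sum_le_expectedRegret μ h.measurable_arm 1 _)
  rw [Finset.sum_range_add]
  refine mul_le_mul (sub_le_gap μ 1 0) ?_ (Finset.sum_nonneg fun _ _ => measureReal_nonneg)
    (gap_nonneg μ 1)
  exact le_add_of_nonneg_of_le (Finset.sum_nonneg fun _ _ => measureReal_nonneg)
    (Finset.sum_le_sum fun k _ => measureReal_mono (hpulled k))

/-! ### Decay of the probability that only the known arm is pulled -/

lemma two_le_initialPulls (α : ℝ) : 2 ≤ initialPulls α := by
  have : (2 : ℤ) ≤ max 2 (3 - ⌈2 * α⌉) := le_max_left _ _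
  unfold initialPulls
  lia

lemma three_sub_ceil_le_initialPulls (α : ℝ) : 3 - (⌈2 * α⌉ : ℝ) ≤ initialPulls α := by
  have : 3 - ⌈2 * α⌉ ≤ (initialPulls α : ℤ) := (le_max_right _ _).trans (Int.self_le_toNat _)
  exact_mod_cast this

lemma one_le_dof_initialPulls (α : ℝ) : 1 ≤ dof α (initialPulls α) := by
  unfold dof
  linarith [three_sub_ceil_le_initialPulls α, Int.ceil_lt_add_one (2 * α)]

/-- The exponent of the decay in `k` of the probability that only the known arm is pulled in the
first `k` rounds after the initialization. -/
noncomputable def decayExponent (α : ℝ) : ℝ :=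
  ((initialPulls α : ℝ) - 1) / dof α (initialPulls α)

lemma one_lt_cast_initialPulls (α : ℝ) : (1 : ℝ) < initialPulls α :=
  mod_cast two_le_initialPulls α

lemma decayExponent_nonneg (α : ℝ) : 0 ≤ decayExponent α :=
  div_nonneg (by linarith [one_lt_cast_initialPulls α]) (by linarith [one_le_dof_initialPulls α])

lemma decayExponent_le_one {α : ℝ} (hα : 0 ≤ α) : decayExponent α ≤ 1 := by
  rw [decayExponent, div_le_one (by linarith [one_le_dof_initialPulls α]), dof]
  linarith

lemma decayExponent_lt_one {α : ℝ} (hα : 0 < α) : decayExponent α < 1 := by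
  rw [decayExponent, div_lt_one (by linarith [one_le_dof_initialPulls α]), dof]
  linarith

lemma exists_nat_le_rpow {x d : ℝ} (hx : 1 ≤ x) (hd : 0 < d) :
    ∃ M : ℕ, 0 < M ∧ x ≤ (M : ℝ) ^ d ∧ (M : ℝ) ≤ 2 * x ^ (1 / d) := by
  have hr : 1 ≤ x ^ (1 / d) := Real.one_le_rpow hx (by positivity)
  refine ⟨⌈x ^ (1 / d)⌉₊, Nat.ceil_pos.2 (by linarith), ?_, ?_⟩
  · calc x = (x ^ (1 / d)) ^ d := by
          rw [← Real.rpow_mul (by linarith), one_div_mul_cancel hd.ne', Real.rpow_one]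
      _ ≤ (⌈x ^ (1 / d)⌉₊ : ℝ) ^ d :=
          Real.rpow_le_rpow (by linarith) (Nat.le_ceil _) hd.le
  · linarith [Nat.ceil_lt_add_one (zero_le_one.trans hr)]

lemma half_le_one_sub_pow {k : ℕ} (hk : 0 < k) :
    (1 / 2 : ℝ) ≤ (1 - 1 / (2 * k)) ^ k := by
  have hk' : (1 : ℝ) ≤ k := mod_cast hk
  have hinv : 1 / (2 * k : ℝ) ≤ 1 := (div_le_one (by positivity)).2 (by linarith)
  calc (1 / 2 : ℝ) = 1 + k * -(1 / (2 * k)) := by field_simp; norm_num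
    _ ≤ (1 + -(1 / (2 * k))) ^ k := one_add_mul_le_pow (by linarith) k
    _ = (1 - 1 / (2 * k)) ^ k := by rw [← sub_eq_add_neg]

lemma one_div_two_mul_rpow_div_le {d k M : ℝ} (hd : 1 ≤ d) (hk : 0 < k) (hM : 0 < M)
    (hkM : k ≤ M ^ d) : (1 / (2 * M)) ^ d / d ≤ 1 / (2 * k) := by
  calc (1 / (2 * M)) ^ d / d ≤ (1 / (2 * M)) ^ d := div_le_self (by positivity) hd
    _ = 1 / (2 ^ d * M ^ d) := by
        rw [Real.div_rpow zero_le_one (by positivity), Real.one_rpow,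
          Real.mul_rpow zero_le_two hM.le]
    _ ≤ 1 / (2 * k) := by
        gcongr
        exact Real.self_le_rpow_of_one_le one_le_two hd

lemma div_two_pow_mul_one_div_pow_le {g x M : ℝ} {n : ℕ} (hg : 0 ≤ g) (hx : 0 < x) (hM : 0 < M)
    (hMx : M ≤ 2 * x) (hn : 1 ≤ n) :
    (g / 2) ^ n * (1 / x) ^ (n - 1) ≤ 1 / 2 * (M * (g * (1 / M)) ^ n) := by
  obtain ⟨r, rfl⟩ := Nat.exists_eq_add_of_le' hn
  calc (g / 2) ^ (r + 1) * (1 / x) ^ r = 1 / 2 * (g ^ (r + 1) * (1 / (2 * x)) ^ r) := by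
        simp only [div_pow, mul_pow, pow_succ]
        field_simp
    _ ≤ 1 / 2 * (g ^ (r + 1) * (1 / M) ^ r) := by gcongr
    _ = 1 / 2 * (M * (g * (1 / M)) ^ (r + 1)) := by
        simp only [div_pow, mul_pow, pow_succ]
        field_simp

namespace IsThompsonKnownArm

variable {Ω : Type u} [MeasurableSpace Ω] {P : Measure Ω} {α : ℝ} {μ σ : Fin 2 → ℝ}
  {X θ : Fin 2 → ℕ → Ω → ℝ} {J : ℕ → Ω → Fin 2}

lemma mul_pow_le_measureReal_clustered (h : IsThompsonKnownArm P α μ σ X θ J)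
    (hσ : 0 < σ 0) {n : ℕ} (hn : 0 < n) {a ε : ℝ} (hε : 0 ≤ ε) {M : ℕ}
    (ha : a + 2 * M * ε ≤ μ 0) :
    M * (gaussianPDFReal (μ 0) (σ 0 ^ 2).toNNReal a * ε) ^ n
      ≤ P.real (clustered (X 0) n a ε M) := by
  have := h.indep_reward.isProbabilityMeasure
  have hind : iIndepFun (X 0) P :=
    h.indep_reward.precomp (g := fun k : ℕ => ((0 : Fin 2), k))
      fun _ _ hkl => (Prod.ext_iff.1 hkl).2
  have hv : (σ 0 ^ 2).toNNReal ≠ 0 := (Real.toNNReal_pos.2 (by positivity)).ne'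
  refine NormalBandit.mul_pow_le_measureReal_clustered hind (h.measurable_reward 0)
    (h.law_reward 0) hn hε (mul_nonneg (gaussianPDFReal_nonneg _ _ _) hε) fun s has hs => ?_
  simpa only [add_sub_cancel_left] using gaussianPDFReal_mul_le_gaussianReal_real_Ico hv has
    (le_add_of_nonneg_right hε) (hs.trans ha)

lemma half_mul_le_measureReal_sampleBelow [IsProbabilityMeasure P]
    (h : IsThompsonKnownArm P α μ σ X θ J) (hμ : μ 1 ≤ μ 0) (hσ : 0 < σ 0) {k M : ℕ} (hk : 0 < k)
    (hM : 0 < M) (hkM : (k : ℝ) ≤ (M : ℝ) ^ dof α (initialPulls α)) :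
    1 / 2 * (M * (gaussianPDFReal (μ 0) (σ 0 ^ 2).toNNReal (μ 1 - 6) * (1 / M)) ^ initialPulls α)
      ≤ P.real (sampleBelow (θ 0) (μ 1) (2 * initialPulls α) k) := by
  set n := initialPulls α
  have hd : 1 ≤ dof α n := one_le_dof_initialPulls α
  have hn : 2 ≤ n := two_le_initialPulls α
  have hk' : (1 : ℝ) ≤ k := mod_cast hk
  have hM' : (0 : ℝ) < M := mod_cast hM
  have hright : μ 1 - 6 + 2 * M * (1 / M) = μ 1 - 4 := by field_simp; ring
  -- The clusters have length `2 / M` and distance at least `4` from `μ 1`, so that the posterior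
  -- mass above `μ 1` is at most `(1 / (2 * M)) ^ d / d`, where `d = dof α n`.
  set G := clustered (X 0) n (μ 1 - 6) (1 / M) M
  have hG (t : ℕ) : MeasurableSet[past X θ J t] G :=
    @measurableSet_clustered _ _ (past X θ J t) (fun k => measurable_reward_past 0 k t) _ _ _ _
  have hPG := h.mul_pow_le_measureReal_clustered hσ (by lia : 0 < n) (a := μ 1 - 6)
    (ε := 1 / (M : ℝ)) (by positivity) (M := M) (by linarith)
  have hpost : ∀ ω ∈ G,
      1 - 1 / (2 * k : ℝ) ≤ (posteriorMean α n fun k => X 0 k ω).real (Iio (μ 1)) := by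
    intro ω hω
    refine le_trans ?_ (one_sub_le_posteriorMean_real_Iio_of_mem_clustered (by linarith) hn
      (by positivity) (by linarith) hω)
    rw [hright, show 2 * (1 / (M : ℝ)) / (μ 1 - (μ 1 - 4)) = 1 / (2 * M) by field_simp; norm_num]
    exact sub_le_sub_left (one_div_two_mul_rpow_div_le hd (by linarith) hM' hkM) 1
  have hq : 0 ≤ 1 - 1 / (2 * k : ℝ) :=
    sub_nonneg.2 ((div_le_one (by positivity)).2 (by linarith))
  calc _ ≤ (1 - 1 / (2 * k : ℝ)) ^ k * P.real G :=
        mul_le_mul (half_le_one_sub_pow hk) hPG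
          (mul_nonneg hM'.le (pow_nonneg (mul_nonneg (gaussianPDFReal_nonneg _ _ _)
            (by positivity)) _)) (pow_nonneg hq k)
    _ ≤ P.real (G ∩ sampleBelow (θ 0) (μ 1) (2 * n) k) :=
        h.pow_mul_measureReal_le_measureReal_sampleBelow hG hq hpost k
    _ ≤ _ := measureReal_mono inter_subset_right

lemma mul_rpow_neg_le_measureReal_sampleBelow [IsProbabilityMeasure P]
    (h : IsThompsonKnownArm P α μ σ X θ J) (hμ : μ 1 ≤ μ 0) (hσ : 0 < σ 0) {k : ℕ} (hk : 0 < k) :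
    (gaussianPDFReal (μ 0) (σ 0 ^ 2).toNNReal (μ 1 - 6) / 2) ^ initialPulls α
        * (k : ℝ) ^ (-decayExponent α)
      ≤ P.real (sampleBelow (θ 0) (μ 1) (2 * initialPulls α) k) := by
  have hk' : (1 : ℝ) ≤ k := mod_cast hk
  have hd : 0 < dof α (initialPulls α) := by linarith [one_le_dof_initialPulls α]
  obtain ⟨M, hM, hkM, hMk⟩ := exists_nat_le_rpow hk' hd
  refine le_trans ?_ (h.half_mul_le_measureReal_sampleBelow hμ hσ hk hM hkM)
  have hn : 1 ≤ initialPulls α := one_le_two.trans (two_le_initialPulls α)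
  have hpow : (k : ℝ) ^ (-decayExponent α)
      = (1 / (k : ℝ) ^ (1 / dof α (initialPulls α))) ^ (initialPulls α - 1) := by
    rw [one_div, inv_pow, ← Real.rpow_mul_natCast (by positivity), ← Real.rpow_neg (by positivity),
      Nat.cast_sub hn, Nat.cast_one, decayExponent, one_div_mul_eq_div]
  rw [hpow]
  exact div_two_pow_mul_one_div_pow_le (gaussianPDFReal_nonneg _ _ _) (by positivity)
    (by exact_mod_cast hM) hMk hn

end IsThompsonKnownArm

/-! ### Rates -/

lemma le_liminf_div {c : ℝ} {R f : ℕ → ℝ} (hf : ∀ᶠ T in atTop, 0 < f T)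
    (hR : ∀ᶠ T in atTop, c * f T ≤ R T) :
    (c : EReal) ≤ liminf (fun T => ((R T / f T : ℝ) : EReal)) atTop := by
  refine le_liminf_of_le (by isBoundedDefault) ?_
  filter_upwards [hf, hR] with T hfT hRT
  exact EReal.coe_le_coe_iff.2 ((le_div_iff₀ hfT).2 hRT)

lemma log_add_one_le_sum_rpow_neg {γ : ℝ} (hγ : γ ≤ 1) (K : ℕ) :
    Real.log (K + 1) ≤ ∑ k ∈ Finset.range K, ((k + 1 : ℕ) : ℝ) ^ (-γ) := by
  calc Real.log (K + 1) = Real.log ((K + 1 : ℕ) : ℝ) := by push_cast; rfl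
    _ ≤ (harmonic K : ℝ) := log_add_one_le_harmonic K
    _ = ∑ k ∈ Finset.range K, ((k + 1 : ℕ) : ℝ) ^ (-1 : ℝ) := by
        simp [harmonic, Real.rpow_neg_one]
    _ ≤ _ := Finset.sum_le_sum fun k _ =>
        Real.rpow_le_rpow_of_exponent_le (mod_cast k.succ_pos) (neg_le_neg hγ)

lemma rpow_le_sum_rpow_neg {γ : ℝ} (hγ : 0 ≤ γ) {K : ℕ} (hK : 0 < K) :
    (K : ℝ) ^ (1 - γ) ≤ ∑ k ∈ Finset.range K, ((k + 1 : ℕ) : ℝ) ^ (-γ) := by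
  calc (K : ℝ) ^ (1 - γ) = ∑ _k ∈ Finset.range K, (K : ℝ) ^ (-γ) := by
        rw [Finset.sum_const, Finset.card_range, nsmul_eq_mul, sub_eq_add_neg,
          Real.rpow_add (by positivity), Real.rpow_one]
    _ ≤ _ := Finset.sum_le_sum fun k hk => Real.rpow_le_rpow_of_nonpos (by positivity)
        (mod_cast Finset.mem_range.1 hk) (neg_nonpos.2 hγ)

section Rate

variable {c γ : ℝ} {m : ℕ} {R : ℕ → ℝ}

lemma half_le_liminf_div_log (hc : 0 ≤ c) (hγ : γ ≤ 1)
    (hR : ∀ K, c * ∑ k ∈ Finset.range K, ((k + 1 : ℕ) : ℝ) ^ (-γ) ≤ R (m + K)) :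
    ((c / 2 : ℝ) : EReal) ≤ liminf (fun T : ℕ => ((R T / Real.log T : ℝ) : EReal)) atTop := by
  refine le_liminf_div ?_ ?_
  · filter_upwards [eventually_gt_atTop 1] with T hT
    exact Real.log_pos (mod_cast hT)
  filter_upwards [eventually_ge_atTop (2 * m + 1)] with T hT
  obtain ⟨K, rfl⟩ := Nat.exists_eq_add_of_le (by lia : m ≤ T)
  have hTK : ((m + K : ℕ) : ℝ) ≤ ((K : ℝ) + 1) ^ 2 :=
    mod_cast (by nlinarith : m + K ≤ (K + 1) ^ 2)
  calc c / 2 * Real.log (m + K : ℕ) ≤ c / 2 * Real.log (((K : ℝ) + 1) ^ 2) :=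
        mul_le_mul_of_nonneg_left (Real.log_le_log (mod_cast (by lia : 0 < m + K)) hTK)
          (by positivity)
    _ = c * Real.log (K + 1) := by rw [Real.log_pow]; push_cast; ring
    _ ≤ c * ∑ k ∈ Finset.range K, ((k + 1 : ℕ) : ℝ) ^ (-γ) :=
        mul_le_mul_of_nonneg_left (log_add_one_le_sum_rpow_neg hγ K) hc
    _ ≤ R (m + K) := hR K

lemma half_le_liminf_div_rpow (hc : 0 ≤ c) (hγ₀ : 0 ≤ γ) (hγ₁ : γ ≤ 1)
    (hR : ∀ K, c * ∑ k ∈ Finset.range K, ((k + 1 : ℕ) : ℝ) ^ (-γ) ≤ R (m + K)) :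
    ((c / 2 : ℝ) : EReal)
      ≤ liminf (fun T : ℕ => ((R T / (T : ℝ) ^ (1 - γ) : ℝ) : EReal)) atTop := by
  refine le_liminf_div ?_ ?_
  · filter_upwards [eventually_gt_atTop 0] with T hT
    positivity
  filter_upwards [eventually_ge_atTop (2 * m + 1)] with T hT
  obtain ⟨K, rfl⟩ := Nat.exists_eq_add_of_le (by lia : m ≤ T)
  have hTK : ((m + K : ℕ) : ℝ) ≤ 2 * K := mod_cast (by lia : m + K ≤ 2 * K)
  have htwo : (2 : ℝ) ^ (1 - γ) ≤ 2 := Real.rpow_le_self_of_one_le one_le_two (by linarith)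
  calc c / 2 * ((m + K : ℕ) : ℝ) ^ (1 - γ) ≤ c / 2 * (2 * K : ℝ) ^ (1 - γ) :=
        mul_le_mul_of_nonneg_left (Real.rpow_le_rpow (by positivity) hTK (by linarith))
          (by positivity)
    _ = c / 2 * (2 ^ (1 - γ) * (K : ℝ) ^ (1 - γ)) := by
        rw [Real.mul_rpow two_pos.le (by positivity)]
    _ ≤ c / 2 * (2 * (K : ℝ) ^ (1 - γ)) := by gcongr
    _ = c * (K : ℝ) ^ (1 - γ) := by ring
    _ ≤ c * ∑ k ∈ Finset.range K, ((k + 1 : ℕ) : ℝ) ^ (-γ) :=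
        mul_le_mul_of_nonneg_left (rpow_le_sum_rpow_neg hγ₀ (by lia)) hc
    _ ≤ R (m + K) := hR K

end Rate

/-- Twice the constant in the lower bounds for the expected regret; the variance of the known arm
does not enter. -/
noncomputable def regretConst (α μ₁ μ₂ σ₁ : ℝ) : ℝ :=
  (μ₁ - μ₂) * (gaussianPDFReal μ₁ (σ₁ ^ 2).toNNReal (μ₂ - 6) / 2) ^ initialPulls α

lemma regretConst_pos (α : ℝ) {μ₁ μ₂ σ₁ : ℝ} (hμ : μ₂ < μ₁) (hσ : 0 < σ₁) :
    0 < regretConst α μ₁ μ₂ σ₁ :=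
  mul_pos (sub_pos.2 hμ) (pow_pos (half_pos (gaussianPDFReal_pos _ _ _
    (Real.toNNReal_pos.2 (by positivity)).ne')) _)

namespace IsThompsonKnownArm

variable {Ω : Type u} [MeasurableSpace Ω] {P : Measure Ω} [IsProbabilityMeasure P] {α : ℝ}
  {μ σ : Fin 2 → ℝ} {X θ : Fin 2 → ℕ → Ω → ℝ} {J : ℕ → Ω → Fin 2}

lemma regretConst_mul_sum_le_expectedRegret (h : IsThompsonKnownArm P α μ σ X θ J)
    (hμ : μ 1 ≤ μ 0) (hσ : 0 < σ 0) (K : ℕ) :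
    regretConst α (μ 0) (μ 1) (σ 0)
        * ∑ k ∈ Finset.range K, ((k + 1 : ℕ) : ℝ) ^ (-decayExponent α)
      ≤ expectedRegret P μ J (2 * initialPulls α + K) := by
  refine le_trans ?_ (h.sub_mul_sum_le_expectedRegret K)
  rw [regretConst, mul_assoc, Finset.mul_sum]
  exact mul_le_mul_of_nonneg_left (Finset.sum_le_sum fun k _ =>
    h.mul_rpow_neg_le_measureReal_sampleBelow hμ hσ k.succ_pos) (sub_nonneg.2 hμ)

lemma half_regretConst_le_liminf_div_log (h : IsThompsonKnownArm P α μ σ X θ J) (hα : 0 ≤ α)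
    (hμ : μ 1 < μ 0) (hσ : 0 < σ 0) :
    ((regretConst α (μ 0) (μ 1) (σ 0) / 2 : ℝ) : EReal)
      ≤ liminf (fun T : ℕ => ((expectedRegret P μ J T / Real.log T : ℝ) : EReal)) atTop :=
  half_le_liminf_div_log (regretConst_pos α hμ hσ).le (decayExponent_le_one hα)
    (h.regretConst_mul_sum_le_expectedRegret hμ.le hσ)

lemma half_regretConst_le_liminf_div_rpow (h : IsThompsonKnownArm P α μ σ X θ J) (hα : 0 ≤ α)
    (hμ : μ 1 < μ 0) (hσ : 0 < σ 0) :
    ((regretConst α (μ 0) (μ 1) (σ 0) / 2 : ℝ) : EReal)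
      ≤ liminf (fun T : ℕ =>
        ((expectedRegret P μ J T / (T : ℝ) ^ (1 - decayExponent α) : ℝ) : EReal)) atTop :=
  half_le_liminf_div_rpow (regretConst_pos α hμ hσ).le (decayExponent_nonneg α)
    (decayExponent_le_one hα) (h.regretConst_mul_sum_le_expectedRegret hμ.le hσ)

end IsThompsonKnownArm

lemma exists_div_Dinf_lt {Δ ξ : ℝ} (hΔ : 0 < Δ) (hξ : 0 < ξ) :
    ∃ s : ℝ, 0 < s ∧ ∀ σ : ℝ, 0 < σ → σ < s → Δ / Dinf Δ (σ ^ 2) < ξ := by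
  refine ⟨Δ * Real.exp (-(Δ / ξ)), by positivity, fun σ hσ hσs => ?_⟩
  have hexp : Real.exp (Δ / ξ) < Δ / σ := by
    rw [lt_div_iff₀ hσ, ← lt_div_iff₀' (Real.exp_pos _)]
    rwa [Real.exp_neg, ← div_eq_mul_inv] at hσs
  have hDinf : Δ / ξ < Dinf Δ (σ ^ 2) := by
    calc Δ / ξ < Real.log (Δ / σ) := (Real.lt_log_iff_exp_lt (by positivity)).2 hexp
      _ = 1 / 2 * Real.log (Δ ^ 2 / σ ^ 2) := by
          rw [← div_pow, Real.log_pow]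
          push_cast
          ring
      _ ≤ Dinf Δ (σ ^ 2) := by
          unfold Dinf
          gcongr
          linarith
  rw [div_lt_iff₀ (lt_trans (by positivity) hDinf), ← div_lt_iff₀' hξ]
  exact hDinf

end NormalBandit

theorem theorem2 (α : ℝ) (hα : 0 ≤ α) (μ₁ μ₂ σ₁ : ℝ) (hμ : μ₂ < μ₁) (hσ₁ : 0 < σ₁) :
    -- at least logarithmic regret, with a constant that does not depend on `σ₂`
    (∃ ξ : ℝ, 0 < ξ ∧ ∀ σ₂ : ℝ, 0 < σ₂ →
      ∀ (Ω : Type u) [MeasurableSpace Ω] (P : Measure Ω) [IsProbabilityMeasure P]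
        (X θ : Fin 2 → ℕ → Ω → ℝ) (J : ℕ → Ω → Fin 2),
        NormalBandit.IsThompsonKnownArm P α ![μ₁, μ₂] ![σ₁, σ₂] X θ J →
        (ξ : EReal) ≤ liminf (fun T : ℕ =>
          ((NormalBandit.expectedRegret P ![μ₁, μ₂] J T / Real.log T : ℝ) : EReal)) atTop) ∧
    -- the asymptotic bound is exceeded when `σ₂` is small
    (∃ s : ℝ, 0 < s ∧ ∀ σ₂ : ℝ, 0 < σ₂ → σ₂ < s →
      ∀ (Ω : Type u) [MeasurableSpace Ω] (P : Measure Ω) [IsProbabilityMeasure P]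
        (X θ : Fin 2 → ℕ → Ω → ℝ) (J : ℕ → Ω → Fin 2),
        NormalBandit.IsThompsonKnownArm P α ![μ₁, μ₂] ![σ₁, σ₂] X θ J →
        (((μ₁ - μ₂) / NormalBandit.Dinf (μ₁ - μ₂) (σ₂ ^ 2) : ℝ) : EReal) <
          liminf (fun T : ℕ =>
            ((NormalBandit.expectedRegret P ![μ₁, μ₂] J T / Real.log T : ℝ) : EReal)) atTop) ∧
    -- polynomial regret if `α > 0`
    (0 < α → ∃ ξ' : ℝ, 0 < ξ' ∧ ∃ η : ℝ, 0 < η ∧ ∀ σ₂ : ℝ, 0 < σ₂ →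
      ∀ (Ω : Type u) [MeasurableSpace Ω] (P : Measure Ω) [IsProbabilityMeasure P]
        (X θ : Fin 2 → ℕ → Ω → ℝ) (J : ℕ → Ω → Fin 2),
        NormalBandit.IsThompsonKnownArm P α ![μ₁, μ₂] ![σ₁, σ₂] X θ J →
        (ξ' : EReal) ≤ liminf (fun T : ℕ =>
          ((NormalBandit.expectedRegret P ![μ₁, μ₂] J T / (T : ℝ) ^ η : ℝ) : EReal)) atTop) := by
  have hξ : 0 < NormalBandit.regretConst α μ₁ μ₂ σ₁ / 2 :=
    half_pos (NormalBandit.regretConst_pos α hμ hσ₁)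
  obtain ⟨s, hs, hDinf⟩ := NormalBandit.exists_div_Dinf_lt (sub_pos.2 hμ) hξ
  refine ⟨⟨_, hξ, ?_⟩, ⟨s, hs, ?_⟩, fun hα' =>
    ⟨_, hξ, 1 - NormalBandit.decayExponent α,
      sub_pos.2 (NormalBandit.decayExponent_lt_one hα'), ?_⟩⟩
  · intro σ₂ _ Ω _ P _ X θ J h
    exact h.half_regretConst_le_liminf_div_log hα hμ hσ₁
  · intro σ₂ hσ₂ hσ₂s Ω _ P _ X θ J h
    calc _ < ((NormalBandit.regretConst α μ₁ μ₂ σ₁ / 2 : ℝ) : EReal) :=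
          EReal.coe_lt_coe_iff.2 (hDinf σ₂ hσ₂ hσ₂s)
      _ ≤ _ := h.half_regretConst_le_liminf_div_log hα hμ hσ₁
  · intro σ₂ _ Ω _ P _ X θ J h
    exact h.half_regretConst_le_liminf_div_rpow hα hμ hσ₁
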